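/- Let $\varepsilon>0$ be fixed and, for every $n\ge 1$, let $b=b(n)=\lfloor(1-\varepsilon)n\rfloor$ (with $b=0$ if $\varepsilon\ge 1$). In the $(1:b)$ random-Breaker perfect-matching game on $E(K_{n,n})$, each round consists of a move of Breaker, who claims a uniformly random set of $b$ previously unclaimed edges of $K_{n,n}$ (all of them if fewer than $b$ remain), followed by a move of Maker, who claims one unclaimed edge of his choice, which may depend on the whole history of the game; Maker wins as soon as his edges contain a perfect matching of $K_{n,n}$. Then Maker has strategies $\sigma_n$ (one for each $n$) and there are integers $r(n)=(1+o(1))n$ such that, when Maker plays according to $\sigma_n$, $$\Pr\big[\text{Maker wins the game on } E(K_{n,n}) \text{ within the first } r(n) \text{ rounds}\big]\longrightarrow 1\qquad (n\to\infty).$$ -/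

import Mathlib

open Filter Topology

namespace RandomBreaker

section Game

variable {α : Type*} [DecidableEq α]

/-- One round of the game: the set of elements claimed by Breaker, followed by the element claimed
by Maker (`none` only if Breaker's move has exhausted the board). -/
structure Round (α : Type*) where
  breaker : Finset α
  maker : Option α

/-- The record of all rounds played so far, the most recent round first. -/
abbrev History (α : Type*) := List (Round α)

/-- All elements claimed by Maker so far. -/
def makerSet : History α → Finset α
  | [] => ∅
  | r :: h => r.maker.toFinset ∪ makerSet h

/-- All elements claimed by Breaker so far. -/
def breakerSet : History α → Finset α
  | [] => ∅
  | r :: h => r.breaker ∪ breakerSet h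

/-- The elements of the board `X` that nobody has claimed so far. -/
def unclaimed (X : Finset α) (h : History α) : Finset α :=
  X \ (makerSet h ∪ breakerSet h)

/-- A (deterministic) strategy for Maker on the board `X`: given the complete history `h` of the
previous rounds and Breaker's move `B` in the current round, it picks an element that is still
unclaimed, whenever there is one. -/
def MakerStrategy (X : Finset α) : Type _ :=
  ∀ (h : History α) (B : Finset α), (unclaimed X h \ B).Nonempty → {x : α // x ∈ unclaimed X h \ B}

/-- The current round, in which Breaker has claimed `B` and Maker answers according to `σ`. -/
def playRound {X : Finset α} (σ : MakerStrategy X) (h : History α) (B : Finset α) : Round α where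
  breaker := B
  maker := if hB : (unclaimed X h \ B).Nonempty then some (σ h B hB).1 else none

/-- Random Breaker's move: a uniformly random set of `b` unclaimed elements
(all of the unclaimed elements, if there are fewer than `b`). -/
noncomputable def breakerMove (X : Finset α) (b : ℕ) (h : History α) : PMF (Finset α) :=
  PMF.uniformOfFinset
    (Finset.powersetCard (min b (unclaimed X h).card) (unclaimed X h))
    (Finset.powersetCard_nonempty.2 (min_le_right _ _))

/-- The law of the history of the first `t` rounds of the `(1 : b)` random-Breaker game on the
board `X` when Maker plays according to `σ`. Breaker moves first in every round. -/
noncomputable def playLaw (X : Finset α) (b : ℕ) (σ : MakerStrategy X) : ℕ → PMF (History α)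
  | 0 => PMF.pure []
  | t + 1 => (playLaw X b σ t).bind fun h =>
      (breakerMove X b h).map fun B => playRound σ h B :: h

/-- The probability that Maker, playing according to `σ`, fully occupies a member of the family
`𝓕` of winning sets within the first `t` rounds of the `(1 : b)` random-Breaker game on `X`.
(Maker's set only grows, so it suffices to look at it after round `t`.) -/
noncomputable def winProb (X : Finset α) (𝓕 : Set (Finset α)) (b : ℕ) (σ : MakerStrategy X)
    (t : ℕ) : ENNReal :=
  (playLaw X b σ t).toOuterMeasure {h | ∃ S ∈ 𝓕, S ⊆ makerSet h}

end Game

open Classical in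
/-- The edge set of `K_{n,n}`. -/
noncomputable def board (n : ℕ) : Finset (Sym2 (Fin n ⊕ Fin n)) :=
  (completeBipartiteGraph (Fin n) (Fin n)).edgeFinset

/-- The winning sets of the perfect-matching game on `K_{n,n}`: all sets of edges of `K_{n,n}`
that contain the edge set of a perfect matching of `K_{n,n}`. -/
def matchingSets (n : ℕ) : Set (Finset (Sym2 (Fin n ⊕ Fin n))) :=
  {S | S ⊆ board n ∧ ∃ P : (completeBipartiteGraph (Fin n) (Fin n)).Subgraph,
    P.IsPerfectMatching ∧ P.edgeSet ⊆ (S : Set (Sym2 (Fin n ⊕ Fin n)))}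

end RandomBreaker

/-!
Let `m` be about `n ^ (1/4)`. Suppose that the edges Breaker owns at the end are sparse (`Sparse`):
outside them every vertex has degree at least `m`, and there is an edge between any two sets of `m`
vertices on opposite sides. Then, against any play of Breaker leading there, Maker completes a
perfect matching within `n + 2 m ^ 2` rounds. While more than `m` vertices on each side are
unmatched, he extends his matching greedily. Then he raises the degrees of the at most `2 m`
unmatched vertices in his own graph to `m`, which takes at most `2 m ^ 2` rounds. Finally, each
further round gains a matched pair: for an unmatched pair `u`, `v`, an edge available between the
partners of the neighbours of `u` and the partners of the neighbours of `v` completes an augmenting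
path. As sparsity passes to smaller sets, Breaker's eventual set can be used in every round, although
Maker does not know it. All this is encoded in one potential of Maker's graph, which he minimises
greedily: `exists_potential_lt` shows that it drops by at least one per round until it vanishes.

For the probability, a fixed set `S` of edges is claimed entirely by Breaker within `T` rounds with
probability at most `(1 - u / n ^ 2) ^ #S`, where `u` is a lower bound for the number of edges
unclaimed at time `T`, whatever Maker's strategy is (`prob_subset_breakerSet_le`). This is a
supermartingale argument resting on the negative dependence of sampling without replacement
(`sum_pow_card_sdiff_le`). For `T = (1 + o(1)) n` the ratio `u / n ^ 2` stays above some constant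
`δ > 0` depending on `ε`. If Breaker's set is not sparse, it contains one of at most
`3 n ^ (2 m)` obstacles, each of size at least `m ^ 2`. The union bound
`3 n ^ (2 m) (1 - δ) ^ (m ^ 2)` tends to zero because `m` grows faster than `log n`.
-/

namespace RandomBreaker

/-! ### Expectations under discrete laws -/

section Expectation

variable {β γ : Type*}

/-- The expectation of an extended-nonnegative function under a discrete law. -/
noncomputable def expect (p : PMF β) (f : β → ENNReal) : ENNReal := ∑' a, p a * f a

lemma expect_pure (a : β) (f : β → ENNReal) : expect (PMF.pure a) f = f a := by
  classical
  unfold expect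
  rw [tsum_eq_single a]
  · simp
  · intro b hb
    simp [PMF.pure_apply, hb]

lemma expect_bind (p : PMF β) (g : β → PMF γ) (f : γ → ENNReal) :
    expect (p.bind g) f = expect p fun a => expect (g a) f := by
  simp only [expect, PMF.bind_apply, ← ENNReal.tsum_mul_right, ← ENNReal.tsum_mul_left]
  rw [ENNReal.tsum_comm]
  simp only [mul_assoc]

lemma expect_map (p : PMF β) (g : β → γ) (f : γ → ENNReal) :
    expect (p.map g) f = expect p fun a => f (g a) := by
  rw [← PMF.bind_pure_comp, expect_bind]
  simp only [Function.comp, expect_pure]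

lemma expect_mono {p : PMF β} {f g : β → ENNReal} (hfg : ∀ a ∈ p.support, f a ≤ g a) :
    expect p f ≤ expect p g := by
  refine ENNReal.tsum_le_tsum fun a => ?_
  by_cases ha : a ∈ p.support
  · exact mul_le_mul_right (hfg a ha) _
  · simp [(p.apply_eq_zero_iff a).2 ha]

lemma expect_one (p : PMF β) : expect p (fun _ => 1) = 1 := by
  simp [expect, p.tsum_coe]

lemma expect_add (p : PMF β) (f g : β → ENNReal) :
    expect p (fun a => f a + g a) = expect p f + expect p g := by
  simp only [expect, mul_add, ENNReal.tsum_add]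

lemma expect_sum {ι : Type*} (p : PMF β) (s : Finset ι) (f : ι → β → ENNReal) :
    expect p (fun a => ∑ i ∈ s, f i a) = ∑ i ∈ s, expect p (f i) := by
  simp only [expect, Finset.mul_sum]
  exact Summable.tsum_finsetSum fun _ _ => ENNReal.summable

lemma toOuterMeasure_eq_expect (p : PMF β) (s : Set β) :
    p.toOuterMeasure s = expect p (s.indicator fun _ => 1) := by
  rw [PMF.toOuterMeasure_apply, expect]
  refine tsum_congr fun a => ?_
  by_cases ha : a ∈ s <;> simp [ha]

lemma expect_uniformOfFinset (s : Finset β) (hs : s.Nonempty) (f : β → ENNReal) :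
    expect (PMF.uniformOfFinset s hs) f = (s.card : ENNReal)⁻¹ * ∑ a ∈ s, f a := by
  rw [expect, tsum_eq_sum (s := s), Finset.mul_sum]
  · refine Finset.sum_congr rfl fun a ha => ?_
    rw [PMF.uniformOfFinset_apply_of_mem hs ha]
  · intro a ha
    rw [PMF.uniformOfFinset_apply_of_notMem hs ha, zero_mul]

end Expectation

/-! ### Negative dependence in sampling without replacement -/

section Sampling

lemma descFactorial_mul_pow_le {k w : ℕ} (hkw : k ≤ w) (a : ℕ) :
    k.descFactorial a * w ^ a ≤ w.descFactorial a * k ^ a := by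
  induction a with
  | zero => simp
  | succ a ih =>
    have h1 : (k - a) * w ≤ (w - a) * k := by
      rw [Nat.sub_mul, Nat.sub_mul, mul_comm k w]
      exact Nat.sub_le_sub_left (Nat.mul_le_mul_left a hkw) _
    calc k.descFactorial (a + 1) * w ^ (a + 1)
        = ((k - a) * w) * (k.descFactorial a * w ^ a) := by
          rw [Nat.descFactorial_succ, pow_succ]; ring
      _ ≤ ((w - a) * k) * (w.descFactorial a * k ^ a) := Nat.mul_le_mul h1 ih
      _ = w.descFactorial (a + 1) * k ^ (a + 1) := by
          rw [Nat.descFactorial_succ, pow_succ]; ring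

variable {α : Type*} [DecidableEq α]

/-- A fixed set `A` lies in a uniformly random `k`-subset of `W` with probability at most
`(k / #W) ^ #A`. -/
lemma card_supersets_le (W A : Finset α) {k : ℕ} (hk : k ≤ W.card) :
    (((W.powersetCard k).filter fun B => A ⊆ B).card : ℝ)
      ≤ (W.card.choose k : ℝ) * ((k : ℝ) / W.card) ^ A.card := by
  by_cases hA : A ⊆ W ∧ A.card ≤ k
  · obtain ⟨hAW, hAk⟩ := hA
    have hcount : ((W.powersetCard k).filter fun B => A ⊆ B).card
        ≤ (W.card - A.card).choose (k - A.card) := by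
      rw [← Finset.card_sdiff_of_subset hAW, ← Finset.card_powersetCard]
      refine Finset.card_le_card_of_injOn (fun B => B \ A) ?_ ?_
      · intro B hB
        simp only [Finset.mem_coe, Finset.mem_filter, Finset.mem_powersetCard] at hB ⊢
        exact ⟨Finset.sdiff_subset_sdiff hB.1.1 le_rfl, by
          rw [Finset.card_sdiff_of_subset hB.2, hB.1.2]⟩
      · intro B hB C hC hBC
        simp only [Finset.mem_coe, Finset.mem_filter, Finset.mem_powersetCard] at hB hC
        simp only at hBC
        rw [← Finset.sdiff_union_of_subset hB.2, ← Finset.sdiff_union_of_subset hC.2, hBC]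
    have hAw : A.card ≤ W.card := Finset.card_le_card hAW
    have hmul := Nat.choose_mul (n := W.card) (k := k) (s := A.card) hAk
    have hd := descFactorial_mul_pow_le hk A.card
    have hpos : 0 < W.card.choose A.card := Nat.choose_pos hAw
    rw [Nat.descFactorial_eq_factorial_mul_choose, Nat.descFactorial_eq_factorial_mul_choose,
      mul_assoc, mul_assoc] at hd
    have hd' := Nat.le_of_mul_le_mul_left hd (Nat.factorial_pos _)
    have key : (W.card - A.card).choose (k - A.card) * W.card ^ A.card
        ≤ W.card.choose k * k ^ A.card := by
      refine Nat.le_of_mul_le_mul_left ?_ hpos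
      calc W.card.choose A.card * ((W.card - A.card).choose (k - A.card) * W.card ^ A.card)
          = W.card.choose k * (k.choose A.card * W.card ^ A.card) := by
            rw [← mul_assoc, ← hmul, mul_assoc]
        _ ≤ W.card.choose k * (W.card.choose A.card * k ^ A.card) := Nat.mul_le_mul_left _ hd'
        _ = _ := by ring
    refine (Nat.cast_le.2 hcount).trans ?_
    rcases Nat.eq_zero_or_pos W.card with h0 | h0
    · have : A.card = 0 := by omega
      simp [h0, this, show k = 0 by omega]
    · rw [div_pow, ← mul_div_assoc, le_div_iff₀ (by positivity)]
      exact_mod_cast key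
  · rw [Finset.filter_false_of_mem]
    · simp only [Finset.card_empty, Nat.cast_zero]
      positivity
    · intro B hB hAB
      rw [Finset.mem_powersetCard] at hB
      exact hA ⟨hAB.trans hB.1, hB.2 ▸ Finset.card_le_card hAB⟩

/-- The events `x ∈ B`, for a uniformly random `k`-subset `B` of `W`, are negatively dependent:
the generating function of `#(S \ B)` is at most its value for independent events of
probability `k / #W`. -/
lemma sum_pow_card_sdiff_le (W S : Finset α) {k : ℕ} (hk : k ≤ W.card) {q : ℝ}
    (hq0 : 0 ≤ q) (hq1 : q ≤ 1) :
    ∑ B ∈ W.powersetCard k, q ^ (S \ B).card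
      ≤ (W.card.choose k : ℝ) * ((1 - q) * ((k : ℝ) / W.card) + q) ^ S.card := by
  have hexp : ∀ B : Finset α, q ^ (S \ B).card
      = ∑ A ∈ S.powerset, (if A ⊆ B then 1 else 0) * ((1 - q) ^ A.card * q ^ (S \ A).card) := by
    intro B
    have h1 : q ^ (S \ B).card = ∏ x ∈ S, ((if x ∈ B then 1 - q else 0) + q) := by
      rw [← Finset.prod_sdiff (Finset.sdiff_subset : S \ B ⊆ S), ← Finset.prod_const]
      have h2 : ∏ x ∈ S \ (S \ B), ((if x ∈ B then 1 - q else 0) + q) = 1 := by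
        refine Finset.prod_eq_one fun x hx => ?_
        have : x ∈ B := by
          simp only [Finset.mem_sdiff] at hx; tauto
        simp [this]
      rw [h2, one_mul]
      refine Finset.prod_congr rfl fun x hx => ?_
      simp [(Finset.mem_sdiff.1 hx).2]
    rw [h1, Finset.prod_add]
    refine Finset.sum_congr rfl fun A _ => ?_
    rw [Finset.prod_const, ← mul_assoc]
    congr 1
    split_ifs with hAB
    · rw [one_mul, ← Finset.prod_const]
      exact Finset.prod_congr rfl fun x hx => by simp [hAB hx]
    · obtain ⟨x, hxA, hxB⟩ := Finset.not_subset.1 hAB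
      rw [zero_mul]
      exact Finset.prod_eq_zero hxA (by simp [hxB])
  have hrhs : ((1 - q) * ((k : ℝ) / W.card) + q) ^ S.card
      = ∑ A ∈ S.powerset, ((1 - q) * ((k : ℝ) / W.card)) ^ A.card * q ^ (S \ A).card := by
    rw [← Finset.prod_const, Finset.prod_add]
    simp only [Finset.prod_const]
  rw [Finset.sum_congr rfl fun B _ => hexp B, Finset.sum_comm, hrhs, Finset.mul_sum]
  refine Finset.sum_le_sum fun A _ => ?_
  rw [← Finset.sum_mul, Finset.sum_boole]
  calc _ ≤ ((W.card.choose k : ℝ) * ((k : ℝ) / W.card) ^ A.card)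
          * ((1 - q) ^ A.card * q ^ (S \ A).card) :=
        mul_le_mul_of_nonneg_right (card_supersets_le W A hk)
          (mul_nonneg (pow_nonneg (by linarith) _) (pow_nonneg hq0 _))
    _ = _ := by rw [mul_pow]; ring

end Sampling

/-! ### Sets claimed entirely by Breaker -/

section RandomBreakerBound

variable {α : Type*} [DecidableEq α]

lemma expect_breakerMove_le (X S : Finset α) (b : ℕ) (h : History α) {q u : ℝ}
    (hq0 : 0 ≤ q) (hq1 : q ≤ 1) (hu : 0 < u) (hU : u ≤ (unclaimed X h).card) :
    expect (breakerMove X b h) (fun B => ENNReal.ofReal (q ^ (S \ B).card))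
      ≤ ENNReal.ofReal (((1 - q) * ((b : ℝ) / u) + q) ^ S.card) := by
  have hle : min b (unclaimed X h).card ≤ (unclaimed X h).card := min_le_right _ _
  rw [breakerMove, expect_uniformOfFinset, Finset.card_powersetCard,
    ← ENNReal.ofReal_sum_of_nonneg fun B _ => pow_nonneg hq0 _]
  set W := unclaimed X h
  have hc : (0 : ℝ) < (W.card.choose (min b W.card) : ℝ) := by
    exact_mod_cast Nat.choose_pos hle
  rw [← ENNReal.ofReal_natCast, ← ENNReal.ofReal_inv_of_pos hc,
    ← ENNReal.ofReal_mul (inv_nonneg.2 hc.le)]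
  refine ENNReal.ofReal_le_ofReal ?_
  rw [inv_mul_le_iff₀ hc]
  refine (sum_pow_card_sdiff_le W S hle hq0 hq1).trans ?_
  have h1 : ((min b W.card : ℕ) : ℝ) / W.card ≤ b / u :=
    div_le_div₀ (Nat.cast_nonneg _) (by exact_mod_cast min_le_left _ _) hu hU
  have h2 : 0 ≤ 1 - q := by linarith
  gcongr

lemma card_claimed_le_of_mem_support (X : Finset α) (b : ℕ) (σ : MakerStrategy X) (t : ℕ) :
    ∀ h ∈ (playLaw X b σ t).support,
      (makerSet h).card ≤ t ∧ (breakerSet h).card ≤ t * b := by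
  induction t with
  | zero => simp [playLaw, makerSet, breakerSet]
  | succ t ih =>
    intro h hh
    simp only [playLaw, PMF.mem_support_bind_iff, PMF.mem_support_map_iff] at hh
    obtain ⟨h', hh', B, hB, rfl⟩ := hh
    rw [breakerMove, PMF.mem_support_uniformOfFinset_iff, Finset.mem_powersetCard] at hB
    obtain ⟨h1, h2⟩ := ih h' hh'
    constructor
    · refine (Finset.card_union_le _ _).trans ?_
      have : ((playRound σ h' B).maker.toFinset).card ≤ 1 := by
        rw [Option.card_toFinset]
        cases (playRound σ h' B).maker <;> simp
      omega
    · refine (Finset.card_union_le _ _).trans ?_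
      have : (playRound σ h' B).breaker.card ≤ b := by
        change B.card ≤ b
        rw [hB.2]; exact min_le_left _ _
      rw [Nat.succ_mul]
      omega

lemma card_unclaimed_ge (X : Finset α) (b : ℕ) (σ : MakerStrategy X) (t : ℕ) (h : History α)
    (hh : h ∈ (playLaw X b σ t).support) :
    (X.card : ℝ) - t * (b + 1) ≤ (unclaimed X h).card := by
  obtain ⟨h1, h2⟩ := card_claimed_le_of_mem_support X b σ t h hh
  have h3 : X.card ≤ (unclaimed X h).card + (makerSet h ∪ breakerSet h).card := by
    have := Finset.le_card_sdiff (makerSet h ∪ breakerSet h) X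
    unfold unclaimed
    omega
  have h4 := Finset.card_union_le (makerSet h) (breakerSet h)
  have h5 : X.card ≤ (unclaimed X h).card + (t + t * b) := by omega
  have h6 : (X.card : ℝ) ≤ (unclaimed X h).card + (t + t * b) := by exact_mod_cast h5
  linarith

/-- Whatever Maker does, a fixed set `S` is entirely claimed by Breaker within `T` rounds with
probability at most `(1 - u_T / u_0) ^ #S`, where `u_t = #X - t (b + 1)` bounds the number of
unclaimed elements after `t` rounds from below. With `q_t = 1 - u_T / u_t`, the expectation of
`q_t ^ #(S \ breakerSet)` does not increase in `t`, and at `t = T`, where `q_T = 0`, it is the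
probability in question. -/
lemma prob_subset_breakerSet_le (X : Finset α) (b : ℕ) (σ : MakerStrategy X) (T : ℕ)
    (hT : (0 : ℝ) < (X.card : ℝ) - T * (b + 1)) (S : Finset α) :
    expect (playLaw X b σ T) ({h | S ⊆ breakerSet h}.indicator fun _ => 1)
      ≤ ENNReal.ofReal ((1 - ((X.card : ℝ) - T * (b + 1)) / X.card) ^ S.card) := by
  set u : ℕ → ℝ := fun t => (X.card : ℝ) - t * (b + 1) with hu
  set q : ℕ → ℝ := fun t => 1 - u T / u t with hq
  have hupos : ∀ t ≤ T, u T ≤ u t := by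
    intro t ht
    have h1 : (t : ℝ) ≤ T := by exact_mod_cast ht
    have h2 : (0 : ℝ) ≤ (b : ℝ) + 1 := by positivity
    have := mul_le_mul_of_nonneg_right h1 h2
    simp only [hu]; linarith
  have hmain : ∀ t ≤ T, expect (playLaw X b σ t)
      (fun h => ENNReal.ofReal (q t ^ (S \ breakerSet h).card))
      ≤ ENNReal.ofReal (q 0 ^ S.card) := by
    intro t
    induction t with
    | zero => intro _; simp [playLaw, expect_pure, breakerSet]
    | succ t ih =>
      intro ht
      refine le_trans ?_ (ih (by omega))
      rw [playLaw, expect_bind]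
      refine expect_mono fun h hh => ?_
      rw [expect_map]
      have hTt := hupos t (by omega)
      have hTt' := hupos (t + 1) ht
      have hut : 0 < u t := hT.trans_le hTt
      have hut' : 0 < u (t + 1) := hT.trans_le hTt'
      have hq0 : 0 ≤ q (t + 1) := by
        simp only [hq]
        rw [sub_nonneg, div_le_one hut']; exact hTt'
      have hq1 : q (t + 1) ≤ 1 := by
        simp only [hq]
        have : 0 ≤ u T / u (t + 1) := div_nonneg hT.le hut'.le
        linarith
      have hstep := expect_breakerMove_le X (S \ breakerSet h) b h hq0 hq1 hut
        (card_unclaimed_ge X b σ t h hh)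
      have hset : ∀ B : Finset α, S \ breakerSet (playRound σ h B :: h)
          = (S \ breakerSet h) \ B := by
        intro B
        ext x
        simp only [breakerSet, playRound, Finset.mem_sdiff, Finset.mem_union]
        tauto
      simp only [hset]
      refine hstep.trans (ENNReal.ofReal_le_ofReal ?_)
      have hb : (0 : ℝ) ≤ (b : ℝ) / u t := by positivity
      refine pow_le_pow_left₀ (add_nonneg (mul_nonneg (by linarith) hb) hq0) ?_ _
      have hrel : u (t + 1) = u t - b - 1 := by
        simp only [hu]; push_cast; ring
      have hgoal : u T / u t ≤ u T / u (t + 1) * (1 - b / u t) := by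
        rw [one_sub_div hut.ne', div_mul_div_comm, div_le_div_iff₀ hut (by positivity)]
        have : u T * u t * u (t + 1) ≤ u T * u t * (u t - b) :=
          mul_le_mul_of_nonneg_left (by linarith) (by positivity)
        nlinarith
      simp only [hq]
      linarith
  have hfin := hmain T le_rfl
  have hq00 : q 0 = 1 - u T / X.card := by simp [hq, hu]
  have hqT : q T = 0 := by
    simp only [hq]
    rw [div_self hT.ne', sub_self]
  rw [hq00] at hfin
  refine le_trans (expect_mono fun h _ => ?_) hfin
  by_cases hS : S ⊆ breakerSet h
  · simp [hS, Finset.sdiff_eq_empty_iff_subset.2 hS]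
  · simp [hS]

end RandomBreakerBound

/-! ### A potential that Maker can lower in every round -/

section Potential

variable {n : ℕ}

/-- The edge of `K_{n,n}` joining the left vertex `i` and the right vertex `j`. -/
def edge (i j : Fin n) : Sym2 (Fin n ⊕ Fin n) := s(Sum.inl i, Sum.inr j)

lemma edge_inj {i j i' j' : Fin n} : edge i j = edge i' j' ↔ i = i' ∧ j = j' := by
  simp [edge]

lemma edge_mem_board (i j : Fin n) : edge i j ∈ board n := by
  classical
  simp [board, edge, SimpleGraph.mem_edgeFinset]

/-- The degree of the left vertex `i` in the edge set `H`. -/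
def leftDegree (H : Finset (Sym2 (Fin n ⊕ Fin n))) (i : Fin n) : ℕ :=
  (Finset.univ.filter fun j => edge i j ∈ H).card

/-- The degree of the right vertex `j` in the edge set `H`. -/
def rightDegree (H : Finset (Sym2 (Fin n ⊕ Fin n))) (j : Fin n) : ℕ :=
  (Finset.univ.filter fun i => edge i j ∈ H).card

/-- The left vertices left unmatched by the matching `{edge i (π i)} ∩ H`. A matching in `H` is
encoded by a permutation `π` extending it, which also pairs up the unmatched vertices. -/
def unmatched (H : Finset (Sym2 (Fin n ⊕ Fin n))) (π : Equiv.Perm (Fin n)) : Finset (Fin n) :=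
  Finset.univ.filter fun i => edge i (π i) ∉ H

/-- The number of edges still missing at the unmatched vertices for each of these, on both sides,
to have degree at least `m`. -/
def deficit (m : ℕ) (H : Finset (Sym2 (Fin n ⊕ Fin n))) (π : Equiv.Perm (Fin n)) : ℕ :=
  ∑ i ∈ unmatched H π, ((m - leftDegree H i) + (m - rightDegree H (π i)))

/-- An upper bound for the number of rounds Maker still needs when he owns `H` and completes the
matching given by `π`: one round per unmatched pair, and at most `2 m ^ 2` rounds
to raise degrees. -/
def cost (m : ℕ) (H : Finset (Sym2 (Fin n ⊕ Fin n))) (π : Equiv.Perm (Fin n)) : ℕ :=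
  (unmatched H π).card + min (2 * m ^ 2) (deficit m H π)

/-- The least cost over all matchings. -/
def potential (m : ℕ) (H : Finset (Sym2 (Fin n ⊕ Fin n))) : ℕ :=
  Finset.univ.inf' Finset.univ_nonempty (cost m H)

/-- The edge set `D` leaves room for Maker: outside `D` there is an edge between any two sets of
`m` vertices on opposite sides, and every vertex has degree at least `m`. -/
structure Sparse (m : ℕ) (D : Finset (Sym2 (Fin n ⊕ Fin n))) : Prop where
  box : ∀ A C : Finset (Fin n), m ≤ A.card → m ≤ C.card → ∃ a ∈ A, ∃ c ∈ C, edge a c ∉ D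
  left : ∀ i, m ≤ (Finset.univ.filter fun j => edge i j ∉ D).card
  right : ∀ j, m ≤ (Finset.univ.filter fun i => edge i j ∉ D).card

lemma Sparse.anti {m : ℕ} {D D' : Finset (Sym2 (Fin n ⊕ Fin n))} (h : Sparse m D')
    (hD : D ⊆ D') : Sparse m D where
  box A C hA hC := by
    obtain ⟨a, ha, c, hc, hac⟩ := h.box A C hA hC
    exact ⟨a, ha, c, hc, fun h' => hac (hD h')⟩
  left i := (h.left i).trans (Finset.card_le_card fun j hj => by
    simp only [Finset.mem_filter, Finset.mem_univ, true_and] at hj ⊢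
    exact fun h' => hj (hD h'))
  right j := (h.right j).trans (Finset.card_le_card fun i hi => by
    simp only [Finset.mem_filter, Finset.mem_univ, true_and] at hi ⊢
    exact fun h' => hi (hD h'))

variable {m : ℕ} {H H' D : Finset (Sym2 (Fin n ⊕ Fin n))}

lemma leftDegree_mono (h : H ⊆ H') (i : Fin n) : leftDegree H i ≤ leftDegree H' i :=
  Finset.card_le_card (Finset.monotone_filter_right _ fun _ _ hj => h hj)

lemma rightDegree_mono (h : H ⊆ H') (j : Fin n) : rightDegree H j ≤ rightDegree H' j :=
  Finset.card_le_card (Finset.monotone_filter_right _ fun _ _ hi => h hi)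

lemma unmatched_anti (h : H ⊆ H') (π : Equiv.Perm (Fin n)) : unmatched H' π ⊆ unmatched H π :=
  Finset.monotone_filter_right _ fun _ _ hi h' => hi (h h')

lemma deficit_le_mul_card (m : ℕ) (H : Finset (Sym2 (Fin n ⊕ Fin n))) (π : Equiv.Perm (Fin n)) :
    deficit m H π ≤ 2 * m * (unmatched H π).card := by
  rw [mul_comm, ← smul_eq_mul]
  exact Finset.sum_le_card_nsmul _ _ _ fun i _ => by omega

lemma potential_le (m : ℕ) (H : Finset (Sym2 (Fin n ⊕ Fin n))) (π : Equiv.Perm (Fin n)) :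
    potential m H ≤ cost m H π :=
  Finset.inf'_le _ (Finset.mem_univ π)

lemma exists_cost_eq_potential (m : ℕ) (H : Finset (Sym2 (Fin n ⊕ Fin n))) :
    ∃ π, potential m H = cost m H π := by
  obtain ⟨π, -, h⟩ := Finset.exists_mem_eq_inf' Finset.univ_nonempty (cost m H)
  exact ⟨π, h⟩

lemma potential_le_initial (m : ℕ) (H : Finset (Sym2 (Fin n ⊕ Fin n))) :
    potential m H ≤ n + 2 * m ^ 2 := by
  refine (potential_le m H 1).trans (Nat.add_le_add ?_ (min_le_left _ _))
  simpa using Finset.card_le_univ (unmatched H 1)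

lemma potential_anti (h : H ⊆ H') : potential m H' ≤ potential m H := by
  obtain ⟨π, hπ⟩ := exists_cost_eq_potential m H
  rw [hπ]
  refine (potential_le m H' π).trans (Nat.add_le_add
    (Finset.card_le_card (unmatched_anti h π)) (min_le_min le_rfl ?_))
  refine (Finset.sum_le_sum_of_subset (unmatched_anti h π)).trans
    (Finset.sum_le_sum fun i _ => ?_)
  have h1 := leftDegree_mono h i
  have h2 := rightDegree_mono h (π i)
  omega

/-- Greedy step: with more than `m` unmatched vertices on each side, an edge outside `D` joins two
of them. -/
lemma exists_cost_lt_of_large_deficit (hD : Sparse m D) {π : Equiv.Perm (Fin n)}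
    (hdef : 2 * m ^ 2 < deficit m H π) :
    ∃ i j π', edge i j ∉ D ∧ cost m (insert (edge i j) H) π' < cost m H π := by
  have hcard : m ≤ (unmatched H π).card := by
    have h1 := deficit_le_mul_card m H π
    by_contra! h2
    have h3 : 2 * m * (unmatched H π).card ≤ 2 * m * m := Nat.mul_le_mul_left _ h2.le
    nlinarith
  obtain ⟨a, ha, c', hc', hac⟩ := hD.box (unmatched H π) ((unmatched H π).map π.toEmbedding)
    hcard (by rwa [Finset.card_map])
  obtain ⟨c, hc, rfl⟩ := Finset.mem_map.1 hc'
  simp only [Equiv.toEmbedding_apply] at hac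
  refine ⟨a, π c, π * Equiv.swap a c, hac, ?_⟩
  have hsub : unmatched (insert (edge a (π c)) H) (π * Equiv.swap a c)
      ⊆ (unmatched H π).erase a := by
    intro x hx
    simp only [unmatched, Finset.mem_filter, Finset.mem_univ, true_and, Finset.mem_insert,
      not_or, edge_inj, Equiv.Perm.mul_apply] at hx
    have hxa : x ≠ a := by
      rintro rfl
      exact hx.1 ⟨rfl, by rw [Equiv.swap_apply_left]⟩
    refine Finset.mem_erase.2 ⟨hxa, ?_⟩
    by_cases hxc : x = c
    · rw [hxc]; exact hc
    · rw [Equiv.swap_apply_of_ne_of_ne hxa hxc] at hx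
      simpa [unmatched] using hx.2
  have h1 := Finset.card_le_card hsub
  have h2 := Finset.card_erase_lt_of_mem ha
  have h3 : cost m H π = (unmatched H π).card + 2 * m ^ 2 := by
    rw [cost, min_eq_left hdef.le]
  rw [h3]
  exact Nat.add_lt_add_of_lt_of_le (h1.trans_lt h2) (min_le_left _ _)

lemma cost_insert_lt {π : Equiv.Perm (Fin n)} (hdef : deficit m H π ≤ 2 * m ^ 2) {i j k : Fin n}
    (hk : k ∈ unmatched H π)
    (hlt : (m - leftDegree (insert (edge i j) H) k)
        + (m - rightDegree (insert (edge i j) H) (π k))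
      < (m - leftDegree H k) + (m - rightDegree H (π k))) :
    cost m (insert (edge i j) H) π < cost m H π := by
  have hsub := unmatched_anti (Finset.subset_insert (edge i j) H) π
  have hd : deficit m (insert (edge i j) H) π < deficit m H π := by
    refine (Finset.sum_le_sum_of_subset hsub).trans_lt
      (Finset.sum_lt_sum (fun x _ => ?_) ⟨k, hk, hlt⟩)
    have h1 := leftDegree_mono (Finset.subset_insert (edge i j) H) x
    have h2 := rightDegree_mono (Finset.subset_insert (edge i j) H) (π x)
    omega
  have := Finset.card_le_card hsub
  unfold cost
  omega

/-- Degree step: an unmatched vertex of degree less than `m` receives a new edge outside `D`. -/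
lemma exists_cost_lt_of_small_deficit (hD : Sparse m D) {π : Equiv.Perm (Fin n)}
    (hpos : deficit m H π ≠ 0) (hdef : deficit m H π ≤ 2 * m ^ 2) :
    ∃ i j π', edge i j ∉ D ∧ cost m (insert (edge i j) H) π' < cost m H π := by
  obtain ⟨k, hk, hne⟩ := Finset.exists_ne_zero_of_sum_ne_zero hpos
  have hor : leftDegree H k < m ∨ rightDegree H (π k) < m := by omega
  rcases hor with hlt | hlt
  · obtain ⟨j, hj, hjH⟩ := Finset.exists_mem_notMem_of_card_lt_card (hlt.trans_le (hD.left k))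
    simp only [Finset.mem_filter, Finset.mem_univ, true_and] at hj hjH
    refine ⟨k, j, π, hj, cost_insert_lt hdef hk ?_⟩
    have h1 : leftDegree H k < leftDegree (insert (edge k j) H) k := by
      refine Finset.card_lt_card ⟨Finset.monotone_filter_right _
        fun _ _ h => Finset.mem_insert_of_mem h, fun h => hjH ?_⟩
      simpa using h (show j ∈ _ by simp)
    have h2 := rightDegree_mono (Finset.subset_insert (edge k j) H) (π k)
    omega
  · obtain ⟨i, hi, hiH⟩ :=
      Finset.exists_mem_notMem_of_card_lt_card (hlt.trans_le (hD.right (π k)))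
    simp only [Finset.mem_filter, Finset.mem_univ, true_and] at hi hiH
    refine ⟨i, π k, π, hi, cost_insert_lt hdef hk ?_⟩
    have h1 : rightDegree H (π k) < rightDegree (insert (edge i (π k)) H) (π k) := by
      refine Finset.card_lt_card ⟨Finset.monotone_filter_right _
        fun _ _ h => Finset.mem_insert_of_mem h, fun h => hiH ?_⟩
      simpa using h (show i ∈ _ by simp)
    have h2 := leftDegree_mono (Finset.subset_insert (edge i (π k)) H) k
    omega

/-- Augmenting step: if the unmatched pair `i`, `π i` has degree at least `m` on both sides, one
edge outside `D` between the partners of the neighbours of `i` and those of the neighbours of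
`π i` completes an augmenting path of length at most five. -/
lemma exists_cost_lt_of_deficit_eq_zero (hD : Sparse m D) {π : Equiv.Perm (Fin n)}
    (hdef : deficit m H π = 0) {i : Fin n} (hi : i ∈ unmatched H π) :
    ∃ i j π', edge i j ∉ D ∧ cost m (insert (edge i j) H) π' < cost m H π := by
  have hterm := Finset.sum_eq_zero_iff.1 hdef
  have hi0 := hterm i hi
  have hiH : edge i (π i) ∉ H := by simpa [unmatched] using hi
  obtain ⟨a, ha, c', hc', hac⟩ := hD.box
    ((Finset.univ.filter fun j => edge i j ∈ H).map π.symm.toEmbedding)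
    ((Finset.univ.filter fun c => edge c (π i) ∈ H).map π.toEmbedding)
    (by rw [Finset.card_map]; change m ≤ leftDegree H i; omega)
    (by rw [Finset.card_map]; change m ≤ rightDegree H (π i); omega)
  obtain ⟨c, hc, rfl⟩ := Finset.mem_map.1 hc'
  obtain ⟨j, hj, rfl⟩ := Finset.mem_map.1 ha
  obtain ⟨a, rfl⟩ := π.surjective j
  simp only [Equiv.toEmbedding_apply, Equiv.symm_apply_apply, Finset.mem_filter, Finset.mem_univ,
    true_and] at hac hc hj
  have hai : a ≠ i := by rintro rfl; exact hiH hj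
  have hci : c ≠ i := by rintro rfl; exact hiH hc
  -- The permutation `τ` maps `i` to `a`, `a` to `c` and `c` to `i`; it is a transposition if
  -- `a = c`, in which case the new edge is not even used.
  set τ : Equiv.Perm (Fin n) := Equiv.swap i a * Equiv.swap a c with hτ
  have hτi : τ i = a := by
    simp [hτ, Equiv.swap_apply_of_ne_of_ne hai.symm hci.symm]
  have hτc : τ c = i := by simp [hτ]
  have hτa : a ≠ c → τ a = c := fun h => by
    simp [hτ, Equiv.swap_apply_of_ne_of_ne hci h.symm]
  have hτx : ∀ x, x ≠ i → x ≠ a → x ≠ c → τ x = x := fun x h1 h2 h3 => by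
    simp [hτ, Equiv.swap_apply_of_ne_of_ne, h1, h2, h3]
  refine ⟨a, π c, π * τ, hac, ?_⟩
  have hsub : ∀ x ∈ unmatched (insert (edge a (π c)) H) (π * τ),
      x ∈ (unmatched H π).erase i ∧ (π * τ) x = π x := by
    intro x hx
    simp only [unmatched, Finset.mem_filter, Finset.mem_univ, true_and, Finset.mem_insert,
      not_or, edge_inj, Equiv.Perm.mul_apply] at hx
    have hxi : x ≠ i := by
      rintro rfl
      rw [hτi] at hx
      exact hx.2 hj
    have hxc : x ≠ c := by
      rintro rfl
      rw [hτc] at hx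
      exact hx.2 hc
    have hxa : x ≠ a := by
      rintro rfl
      rw [hτa hxc] at hx
      exact hx.1 ⟨rfl, rfl⟩
    rw [hτx x hxi hxa hxc] at hx
    exact ⟨Finset.mem_erase.2 ⟨hxi, by simpa [unmatched] using hx.2⟩, by
      rw [Equiv.Perm.mul_apply, hτx x hxi hxa hxc]⟩
  have hd : deficit m (insert (edge a (π c)) H) (π * τ) = 0 := by
    refine Finset.sum_eq_zero fun x hx => ?_
    obtain ⟨h1, h2⟩ := hsub x hx
    have h3 := hterm x (Finset.mem_of_mem_erase h1)
    have h4 := leftDegree_mono (Finset.subset_insert (edge a (π c)) H) x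
    have h5 := rightDegree_mono (Finset.subset_insert (edge a (π c)) H) (π x)
    rw [h2]
    omega
  have h1 := Finset.card_le_card fun x hx => (hsub x hx).1
  have h2 := Finset.card_erase_lt_of_mem hi
  unfold cost
  omega

/-- As long as the potential is positive, Maker can lower it by claiming one edge
outside `D`. -/
lemma exists_potential_lt (hD : Sparse m D) (hpos : 0 < potential m H) :
    ∃ e ∈ board n, e ∉ H ∧ e ∉ D ∧ potential m (insert e H) < potential m H := by
  obtain ⟨π, hπ⟩ := exists_cost_eq_potential m H
  have hex : ∃ i j π', edge i j ∉ D ∧ cost m (insert (edge i j) H) π' < cost m H π := by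
    rcases lt_or_ge (2 * m ^ 2) (deficit m H π) with h1 | h1
    · exact exists_cost_lt_of_large_deficit hD h1
    · by_cases h2 : deficit m H π = 0
      · obtain ⟨i, hi⟩ : (unmatched H π).Nonempty := by
          rw [Finset.nonempty_iff_ne_empty]
          intro h3
          rw [hπ, cost, h2, h3] at hpos
          simp at hpos
        exact exists_cost_lt_of_deficit_eq_zero hD h2 hi
      · exact exists_cost_lt_of_small_deficit hD h2 h1
  obtain ⟨i, j, π', hij, hlt⟩ := hex
  have hlt' : potential m (insert (edge i j) H) < potential m H :=
    hπ ▸ (potential_le m _ π').trans_lt hlt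
  refine ⟨edge i j, edge_mem_board i j, fun hH => ?_, hij, hlt'⟩
  rw [Finset.insert_eq_of_mem hH] at hlt'
  exact lt_irrefl _ hlt'

/-- At potential zero some permutation `π` has all its edges `edge i (π i)` in `H`; these form a
perfect matching. -/
lemma exists_matchingSet_of_potential_eq_zero (h : potential m H = 0) :
    ∃ S ∈ matchingSets n, S ⊆ H := by
  obtain ⟨π, hπ⟩ := exists_cost_eq_potential m H
  have hall : ∀ i, edge i (π i) ∈ H := by
    intro i
    by_contra hi
    have : 0 < (unmatched H π).card := Finset.card_pos.2 ⟨i, by simpa [unmatched] using hi⟩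
    unfold cost at hπ
    omega
  refine ⟨Finset.univ.image fun i => edge i (π i), ⟨?_, ?_⟩, ?_⟩
  · intro e he
    obtain ⟨i, -, rfl⟩ := Finset.mem_image.1 he
    exact edge_mem_board _ _
  · let P : (completeBipartiteGraph (Fin n) (Fin n)).Subgraph :=
      { verts := Set.univ
        Adj := fun x y => ∃ i, s(x, y) = edge i (π i)
        adj_sub := by
          rintro x y ⟨i, hi⟩
          rw [← SimpleGraph.mem_edgeSet, hi]
          simp [edge]
        edge_vert := fun _ => Set.mem_univ _
        symm := ⟨fun x y ⟨i, hi⟩ => ⟨i, by rw [Sym2.eq_swap]; exact hi⟩⟩ }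
    refine ⟨P, ⟨?_, fun _ => Set.mem_univ _⟩, ?_⟩
    · rintro (x | x) -
      · refine ⟨Sum.inr (π x), ⟨x, rfl⟩, ?_⟩
        rintro y ⟨i, hi⟩
        have : x = i ∧ y = Sum.inr (π i) := by simpa [edge] using hi
        rw [this.2, this.1]
      · refine ⟨Sum.inl (π.symm x), ⟨π.symm x, by simp [edge]⟩, ?_⟩
        rintro y ⟨i, hi⟩
        have : x = π i ∧ y = Sum.inl i := by simpa [edge] using hi
        rw [this.2, this.1, Equiv.symm_apply_apply]
    · intro e he
      induction e with
      | _ x y =>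
        obtain ⟨i, hi⟩ : ∃ i, s(x, y) = edge i (π i) := he
        rw [hi]
        simp
  · intro e he
    obtain ⟨i, -, rfl⟩ := Finset.mem_image.1 he
    exact hall i

/-- The strategy by which Maker claims an unclaimed edge that makes the potential of his graph as small as possible. -/
noncomputable def minPotentialStrategy (n m : ℕ) : MakerStrategy (board n) := fun h _ hB =>
  ⟨(Finset.exists_min_image _ (fun e => potential m (insert e (makerSet h))) hB).choose,
    (Finset.exists_min_image _ (fun e => potential m (insert e (makerSet h))) hB).choose_spec.1⟩

lemma minPotentialStrategy_le (h : History (Sym2 (Fin n ⊕ Fin n)))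
    (B : Finset (Sym2 (Fin n ⊕ Fin n))) (hB : (unclaimed (board n) h \ B).Nonempty)
    {e : Sym2 (Fin n ⊕ Fin n)} (he : e ∈ unclaimed (board n) h \ B) :
    potential m (insert (minPotentialStrategy n m h B hB).1 (makerSet h))
      ≤ potential m (insert e (makerSet h)) :=
  (Finset.exists_min_image _
    (fun e => potential m (insert e (makerSet h))) hB).choose_spec.2 e he

/-- Sparsity of Breaker's final set is inherited by his earlier sets, so the potential has dropped
in each of the first `t` rounds. -/
lemma potential_le_of_mem_support {b : ℕ} (t : ℕ) :
    ∀ h ∈ (playLaw (board n) b (minPotentialStrategy n m) t).support,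
      Sparse m (breakerSet h) → potential m (makerSet h) ≤ n + 2 * m ^ 2 - t := by
  induction t with
  | zero => exact fun h _ _ => potential_le_initial m _
  | succ t ih =>
    intro h hh hs
    simp only [playLaw, PMF.mem_support_bind_iff, PMF.mem_support_map_iff] at hh
    obtain ⟨h', hh', B, -, rfl⟩ := hh
    have hs' : Sparse m (B ∪ breakerSet h') := hs
    have hle := ih h' hh' (hs'.anti Finset.subset_union_right)
    rcases Nat.eq_zero_or_pos (potential m (makerSet h')) with h0 | h0
    · have : potential m (makerSet (playRound (minPotentialStrategy n m) h' B :: h'))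
          ≤ potential m (makerSet h') := potential_anti Finset.subset_union_right
      omega
    · obtain ⟨e, heX, heH, heD, hlt⟩ := exists_potential_lt hs' h0
      have he : e ∈ unclaimed (board n) h' \ B := by
        simp only [unclaimed, Finset.mem_sdiff, Finset.mem_union] at heD ⊢
        tauto
      have hmove := minPotentialStrategy_le (m := m) h' B ⟨e, he⟩ he
      have hset : makerSet (playRound (minPotentialStrategy n m) h' B :: h')
          = insert (minPotentialStrategy n m h' B ⟨e, he⟩).1 (makerSet h') := by
        simp only [makerSet, playRound]
        rw [dif_pos ⟨e, he⟩]
        rfl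
      rw [hset]
      omega

end Potential

/-! ### Sparsity of the set claimed by Breaker -/

section Obstacles

variable {n m : ℕ}

/-- The edge sets of which a non-sparse set contains at least one: all `m × m` boxes, and all
stars with `m` edges removed. -/
def obstacles (n m : ℕ) : Finset (Finset (Sym2 (Fin n ⊕ Fin n))) :=
  ((Finset.univ.powersetCard m ×ˢ Finset.univ.powersetCard m).image
      fun p : Finset (Fin n) × Finset (Fin n) =>
        (p.1 ×ˢ p.2).image fun e : Fin n × Fin n => edge e.1 e.2) ∪
    ((Finset.univ ×ˢ Finset.univ.powersetCard m).image
        (fun p : Fin n × Finset (Fin n) => p.2ᶜ.image fun j => edge p.1 j) ∪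
      (Finset.univ ×ˢ Finset.univ.powersetCard m).image
        fun p : Fin n × Finset (Fin n) => p.2ᶜ.image fun i => edge i p.1)

lemma sparse_of_forall_obstacles (hmn : m ≤ n) {D : Finset (Sym2 (Fin n ⊕ Fin n))}
    (hD : ∀ S ∈ obstacles n m, ¬S ⊆ D) : Sparse m D where
  box A C hA hC := by
    obtain ⟨A', hA', hAm⟩ := Finset.exists_subset_card_eq hA
    obtain ⟨C', hC', hCm⟩ := Finset.exists_subset_card_eq hC
    by_contra! hcon
    refine hD ((A' ×ˢ C').image fun e => edge e.1 e.2) ?_ ?_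
    · exact Finset.mem_union_left _ (Finset.mem_image.2
        ⟨(A', C'), by simp [Finset.mem_powersetCard, hAm, hCm], rfl⟩)
    · intro e he
      obtain ⟨⟨a, c⟩, hac, rfl⟩ := Finset.mem_image.1 he
      rw [Finset.mem_product] at hac
      exact hcon a (hA' hac.1) c (hC' hac.2)
  left i := by
    by_contra! hcon
    obtain ⟨K, hK, hKm⟩ := Finset.exists_superset_card_eq hcon.le (by simpa using hmn)
    refine hD (Kᶜ.image fun j => edge i j) ?_ ?_
    · exact Finset.mem_union_right _ (Finset.mem_union_left _ (Finset.mem_image.2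
        ⟨(i, K), by simp [Finset.mem_powersetCard, hKm], rfl⟩))
    · intro e he
      obtain ⟨j, hj, rfl⟩ := Finset.mem_image.1 he
      by_contra hjD
      exact Finset.mem_compl.1 hj (hK (by simpa using hjD))
  right j := by
    by_contra! hcon
    obtain ⟨K, hK, hKm⟩ := Finset.exists_superset_card_eq hcon.le (by simpa using hmn)
    refine hD (Kᶜ.image fun i => edge i j) ?_ ?_
    · exact Finset.mem_union_right _ (Finset.mem_union_right _ (Finset.mem_image.2
        ⟨(j, K), by simp [Finset.mem_powersetCard, hKm], rfl⟩))
    · intro e he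
      obtain ⟨i, hi, rfl⟩ := Finset.mem_image.1 he
      by_contra hiD
      exact Finset.mem_compl.1 hi (hK (by simpa using hiD))

lemma card_obstacles_le (hm : 1 ≤ m) : (obstacles n m).card ≤ 3 * n ^ (2 * m) := by
  rcases Nat.eq_zero_or_pos n with rfl | hn
  · have h0 : (Finset.univ : Finset (Fin 0)).powersetCard m = ∅ :=
      Finset.powersetCard_eq_empty.2 (by simpa using Nat.lt_of_lt_of_le one_pos hm)
    rw [obstacles, h0]
    simp
  have hch : n.choose m ≤ n ^ m := Nat.choose_le_pow n m
  have h1 : n.choose m * n.choose m ≤ n ^ (2 * m) := by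
    rw [two_mul, pow_add]; exact Nat.mul_le_mul hch hch
  have h2 : n * n.choose m ≤ n ^ (2 * m) :=
    calc n * n.choose m ≤ n ^ m * n ^ m :=
          Nat.mul_le_mul (Nat.le_self_pow (by omega) n) hch
      _ = n ^ (2 * m) := by rw [two_mul, pow_add]
  calc (obstacles n m).card
      ≤ n.choose m * n.choose m + (n * n.choose m + n * n.choose m) := by
        refine (Finset.card_union_le _ _).trans (Nat.add_le_add ?_
          ((Finset.card_union_le _ _).trans (Nat.add_le_add ?_ ?_))) <;>
        refine Finset.card_image_le.trans (le_of_eq ?_) <;>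
        simp [Finset.card_product]
    _ ≤ 3 * n ^ (2 * m) := by omega

lemma sq_le_card_of_mem_obstacles (hmn : m ^ 2 + m ≤ n) {S : Finset (Sym2 (Fin n ⊕ Fin n))}
    (hS : S ∈ obstacles n m) : m ^ 2 ≤ S.card := by
  simp only [obstacles, Finset.mem_union, Finset.mem_image, Finset.mem_product,
    Finset.mem_powersetCard, Prod.exists] at hS
  rcases hS with ⟨A, C, ⟨⟨-, hA⟩, -, hC⟩, rfl⟩ | ⟨i, K, ⟨-, -, hK⟩, rfl⟩ |
    ⟨j, K, ⟨-, -, hK⟩, rfl⟩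
  · rw [Finset.card_image_of_injective, Finset.card_product, hA, hC, sq]
    rintro ⟨a, c⟩ ⟨a', c'⟩ h
    simpa [edge_inj] using h
  · rw [Finset.card_image_of_injective, Finset.card_compl, hK, Fintype.card_fin]
    · omega
    · intro j j' h
      exact (edge_inj.1 h).2
  · rw [Finset.card_image_of_injective, Finset.card_compl, hK, Fintype.card_fin]
    · omega
    · intro i i' h
      exact (edge_inj.1 h).1

lemma card_board (n : ℕ) : (board n).card = n ^ 2 := by
  classical
  have : board n = Finset.univ.image fun p : Fin n × Fin n => edge p.1 p.2 := by
    ext e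
    constructor
    · intro he
      induction e with
      | _ x y =>
        rw [board, SimpleGraph.mem_edgeFinset, SimpleGraph.mem_edgeSet] at he
        rcases x with x | x <;> rcases y with y | y <;> simp [edge] at he ⊢
    · intro he
      obtain ⟨p, -, rfl⟩ := Finset.mem_image.1 he
      exact edge_mem_board _ _
  rw [this, Finset.card_image_of_injective]
  · simp [sq]
  · rintro ⟨a, c⟩ ⟨a', c'⟩ h
    simpa [edge_inj] using h

lemma winProb_le_one {α : Type*} [DecidableEq α] (X : Finset α) (𝓕 : Set (Finset α)) (b : ℕ)
    (σ : MakerStrategy X) (t : ℕ) : winProb X 𝓕 b σ t ≤ 1 := by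
  rw [winProb, toOuterMeasure_eq_expect]
  exact (expect_mono fun h _ => Set.indicator_le_self _ _ h).trans_eq (expect_one _)

/-- Maker wins within `n + 2 m ^ 2` rounds unless Breaker claims an obstacle; the union bound over
all obstacles. -/
lemma one_le_winProb_add (b : ℕ) (hm : 1 ≤ m) (hmn : m ^ 2 + m ≤ n) {ρ : ℝ}
    (hu : (0 : ℝ) < (n : ℝ) ^ 2 - (n + 2 * m ^ 2 : ℕ) * (b + 1))
    (hρ : 1 - ((n : ℝ) ^ 2 - (n + 2 * m ^ 2 : ℕ) * (b + 1)) / (n : ℝ) ^ 2 ≤ ρ) (hρ1 : ρ ≤ 1) :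
    1 ≤ winProb (board n) (matchingSets n) b (minPotentialStrategy n m) (n + 2 * m ^ 2)
      + ENNReal.ofReal (3 * (n : ℝ) ^ (2 * m) * ρ ^ m ^ 2) := by
  set T := n + 2 * m ^ 2 with hT
  set p := playLaw (board n) b (minPotentialStrategy n m) T
  have hX : ((board n).card : ℝ) = (n : ℝ) ^ 2 := by rw [card_board]; push_cast; rfl
  have hn2 : (0 : ℝ) < (n : ℝ) ^ 2 := by
    have : 1 ≤ n := by omega
    positivity
  have hbase : 0 ≤ 1 - ((n : ℝ) ^ 2 - (T : ℝ) * (b + 1)) / (n : ℝ) ^ 2 := by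
    rw [sub_nonneg, div_le_one hn2]
    have : (0 : ℝ) ≤ (T : ℝ) * (b + 1) := by positivity
    linarith
  have hobst : ∀ S ∈ obstacles n m, expect p ({h | S ⊆ breakerSet h}.indicator fun _ => 1)
      ≤ ENNReal.ofReal (ρ ^ m ^ 2) := by
    intro S hS
    have h1 := prob_subset_breakerSet_le (board n) b (minPotentialStrategy n m) T
      (by rw [hX]; exact hu) S
    rw [hX] at h1
    refine h1.trans (ENNReal.ofReal_le_ofReal ?_)
    exact (pow_le_pow_left₀ hbase hρ _).trans
      (pow_le_pow_of_le_one (hbase.trans hρ) hρ1 (sq_le_card_of_mem_obstacles hmn hS))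
  have hsum : expect p (fun h => ∑ S ∈ obstacles n m,
      ({h | S ⊆ breakerSet h}.indicator (fun _ => 1) h : ENNReal))
      ≤ ENNReal.ofReal (3 * (n : ℝ) ^ (2 * m) * ρ ^ m ^ 2) := by
    rw [expect_sum]
    refine (Finset.sum_le_card_nsmul _ _ _ hobst).trans ?_
    rw [nsmul_eq_mul, ENNReal.ofReal_mul (by positivity)]
    refine mul_le_mul_left ?_ _
    rw [← ENNReal.ofReal_natCast]
    exact ENNReal.ofReal_le_ofReal (by exact_mod_cast card_obstacles_le hm)
  refine le_trans ?_ (add_le_add le_rfl hsum)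
  rw [winProb, toOuterMeasure_eq_expect, ← expect_add]
  refine (expect_one p).symm.trans_le (expect_mono fun h hh => ?_)
  by_cases hD : ∀ S ∈ obstacles n m, ¬S ⊆ breakerSet h
  · have hpot := potential_le_of_mem_support T h hh (sparse_of_forall_obstacles (by omega) hD)
    have hwin := exists_matchingSet_of_potential_eq_zero (m := m) (H := makerSet h) (by omega)
    rw [Set.indicator_of_mem (by exact hwin)]
    exact le_self_add
  · push Not at hD
    obtain ⟨S, hS, hSD⟩ := hD
    refine le_trans ?_ le_add_self
    refine le_trans ?_ (Finset.single_le_sum (fun _ _ => zero_le) hS)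
    rw [Set.indicator_of_mem (by exact hSD)]

end Obstacles

/-! ### Asymptotics -/

section Asymptotics

lemma tendsto_natSqrt_atTop : Tendsto Nat.sqrt atTop atTop :=
  tendsto_atTop.2 fun k => (eventually_ge_atTop (k * k)).mono fun _ hn => Nat.le_sqrt.2 hn

/-- The fourth root of `n`, the size of the sets in the expansion property. -/
def fourthRoot (n : ℕ) : ℕ := n.sqrt.sqrt

lemma tendsto_fourthRoot_atTop : Tendsto fourthRoot atTop atTop :=
  tendsto_natSqrt_atTop.comp tendsto_natSqrt_atTop

lemma fourthRoot_sq_le (n : ℕ) : fourthRoot n ^ 2 ≤ n.sqrt := Nat.sqrt_le' _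

lemma le_fourthRoot_add_one_pow (n : ℕ) : n ≤ (fourthRoot n + 1) ^ 4 := by
  have h1 : n < (n.sqrt + 1) ^ 2 := Nat.lt_succ_sqrt' n
  have h2 : n.sqrt + 1 ≤ (fourthRoot n + 1) ^ 2 := Nat.lt_succ_sqrt' n.sqrt
  calc n ≤ (n.sqrt + 1) ^ 2 := h1.le
    _ ≤ ((fourthRoot n + 1) ^ 2) ^ 2 := Nat.pow_le_pow_left h2 2
    _ = _ := by rw [← pow_mul]

lemma tendsto_rounds_div :
    Tendsto (fun n : ℕ => ((n + 2 * fourthRoot n ^ 2 : ℕ) : ℝ) / n) atTop (𝓝 1) := by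
  have hup : Tendsto (fun n : ℕ => 1 + 2 / (n.sqrt : ℝ)) atTop (𝓝 1) := by
    have h1 : Tendsto (fun n : ℕ => (2 : ℝ) / (n.sqrt : ℝ)) atTop (𝓝 0) :=
      (tendsto_const_div_atTop_nhds_zero_nat 2).comp tendsto_natSqrt_atTop
    simpa using h1.const_add 1
  refine tendsto_of_tendsto_of_tendsto_of_le_of_le' tendsto_const_nhds hup ?_ ?_
  · filter_upwards [eventually_ge_atTop 1] with n hn
    have hn0 : (0 : ℝ) < n := by exact_mod_cast hn
    rw [le_div_iff₀ hn0, one_mul]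
    exact_mod_cast Nat.le_add_right _ _
  · filter_upwards [eventually_ge_atTop 1] with n hn
    have hn0 : (0 : ℝ) < n := by exact_mod_cast hn
    have hs : 0 < n.sqrt := Nat.sqrt_pos.2 hn
    have hs0 : (0 : ℝ) < n.sqrt := by exact_mod_cast hs
    have h1 : ((fourthRoot n : ℝ)) ^ 2 ≤ n.sqrt := by exact_mod_cast fourthRoot_sq_le n
    have h2 : (n.sqrt : ℝ) ^ 2 ≤ n := by exact_mod_cast Nat.sqrt_le' n
    rw [div_le_iff₀ hn0, add_mul, one_mul]
    push_cast
    have h3 : (n.sqrt : ℝ) ≤ 1 / n.sqrt * n := by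
      rw [div_mul_eq_mul_div, one_mul, le_div_iff₀ hs0, ← sq]; exact h2
    have h4 : 2 / (n.sqrt : ℝ) * n = 2 * (1 / n.sqrt * n) := by ring
    rw [h4]
    linarith

lemma tendsto_error {ρ : ℝ} (hρ0 : 0 ≤ ρ) (hρ1 : ρ < 1) :
    Tendsto (fun n : ℕ => 3 * (n : ℝ) ^ (2 * fourthRoot n) * ρ ^ fourthRoot n ^ 2)
      atTop (𝓝 0) := by
  have hg : Tendsto (fun m : ℕ => ((m + 1 : ℕ) : ℝ) ^ 8 * ρ ^ m) atTop (𝓝 0) := by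
    rcases hρ0.eq_or_lt with rfl | hpos
    · refine tendsto_const_nhds.congr' ?_
      filter_upwards [eventually_ge_atTop 1] with m hm
      rw [zero_pow (by omega), mul_zero]
    · have h1 := (tendsto_add_atTop_iff_nat 1).2
        (tendsto_pow_const_mul_const_pow_of_lt_one 8 hρ0 hρ1)
      have h2 := h1.mul_const ρ⁻¹
      rw [zero_mul] at h2
      refine h2.congr fun m => ?_
      rw [pow_succ ρ m]
      field_simp
  have hgn := hg.comp tendsto_fourthRoot_atTop
  have hup := hgn.const_mul 3
  rw [mul_zero] at hup
  refine tendsto_of_tendsto_of_tendsto_of_le_of_le' tendsto_const_nhds hup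
    (Eventually.of_forall fun n => by positivity) ?_
  filter_upwards [hgn.eventually_le_const one_pos,
    tendsto_fourthRoot_atTop.eventually_ge_atTop 1] with n hle hm
  set m := fourthRoot n
  simp only [Function.comp_apply] at hle ⊢
  have hnm : (n : ℝ) ≤ ((m + 1 : ℕ) : ℝ) ^ 4 := by exact_mod_cast le_fourthRoot_add_one_pow n
  rw [mul_assoc]
  refine mul_le_mul_of_nonneg_left ?_ (by norm_num)
  calc (n : ℝ) ^ (2 * m) * ρ ^ m ^ 2
      ≤ (((m + 1 : ℕ) : ℝ) ^ 4) ^ (2 * m) * ρ ^ m ^ 2 := by gcongr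
    _ = (((m + 1 : ℕ) : ℝ) ^ 8 * ρ ^ m) ^ m := by
        rw [mul_pow, ← pow_mul, ← pow_mul, ← pow_mul]
        congr 2 <;> ring
    _ ≤ ((m + 1 : ℕ) : ℝ) ^ 8 * ρ ^ m :=
        pow_le_of_le_one (by positivity) hle (by omega)

/-- After `n + o(n)` rounds with bias `b ≤ (1 - 2 δ) n`, a proportion of at least `δ` of the board
is still unclaimed. -/
lemma eventually_unclaimed_ge {δ : ℝ} (hδ : 0 < δ) (hδ1 : 2 * δ ≤ 1) :
    ∀ᶠ n : ℕ in atTop, ∀ b : ℕ, (b : ℝ) ≤ (1 - 2 * δ) * n →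
      δ * (n : ℝ) ^ 2 ≤ (n : ℝ) ^ 2 - (n + 2 * fourthRoot n ^ 2 : ℕ) * (b + 1) := by
  filter_upwards [(tendsto_natCast_atTop_atTop.comp
    tendsto_natSqrt_atTop).eventually_ge_atTop (5 / δ), eventually_ge_atTop 1] with n hs hn b hb
  simp only [Function.comp_apply] at hs
  rw [div_le_iff₀ hδ] at hs
  have hn1 : (1 : ℝ) ≤ n := by exact_mod_cast hn
  have hs1 : (1 : ℝ) ≤ n.sqrt := by exact_mod_cast Nat.sqrt_pos.2 hn
  have h1 : ((fourthRoot n : ℝ)) ^ 2 ≤ n.sqrt := by exact_mod_cast fourthRoot_sq_le n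
  have h2 : (n.sqrt : ℝ) ^ 2 ≤ n := by exact_mod_cast Nat.sqrt_le' n
  push_cast
  set s : ℝ := (n.sqrt : ℝ)
  set N : ℝ := (n : ℝ)
  have h3 : (N + 2 * (fourthRoot n : ℝ) ^ 2) * (b + 1) ≤ (N + 2 * s) * ((1 - 2 * δ) * N + 1) := by
    gcongr
  have h4 : (N + 2 * s) * ((1 - 2 * δ) * N + 1) ≤ (1 - 2 * δ) * N ^ 2 + 5 * N * s := by
    have h5 : N ≤ N * s := le_mul_of_one_le_right (by linarith) hs1
    have h6 : s ≤ N * s := le_mul_of_one_le_left (by linarith) hn1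
    have h7 : 0 ≤ δ * (N * s) := by positivity
    nlinarith
  have h8 : 5 * N * s ≤ δ * N ^ 2 := by
    have h9 : 5 * s ≤ δ * s ^ 2 := by nlinarith
    have h10 : δ * s ^ 2 ≤ δ * N := by gcongr
    have h11 : N * (5 * s) ≤ N * (δ * N) :=
      mul_le_mul_of_nonneg_left (h9.trans h10) (by linarith)
    nlinarith
  linarith

end Asymptotics

end RandomBreaker

theorem theorem2 (ε : ℝ) (hε : 0 < ε) :
    ∃ (σ : ∀ n : ℕ, RandomBreaker.MakerStrategy (RandomBreaker.board n)) (r : ℕ → ℕ),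
      Tendsto (fun n : ℕ => (r n : ℝ) / (n : ℝ)) atTop (𝓝 1) ∧
      Tendsto (fun n : ℕ =>
          RandomBreaker.winProb (RandomBreaker.board n) (RandomBreaker.matchingSets n)
            ⌊(1 - ε) * (n : ℝ)⌋₊ (σ n) (r n))
        atTop (𝓝 1) := by
  open RandomBreaker in
  refine ⟨fun n => minPotentialStrategy n (fourthRoot n), fun n => n + 2 * fourthRoot n ^ 2,
    tendsto_rounds_div, ?_⟩
  -- Replacing `ε` by `min ε 1` covers the case `ε ≥ 1`, where `b = 0`.
  obtain ⟨δ, hδ, hδ1, hδε⟩ : ∃ δ : ℝ, 0 < δ ∧ 2 * δ ≤ 1 ∧ 2 * δ ≤ ε :=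
    ⟨min ε 1 / 2, by positivity, by linarith [min_le_right ε 1], by linarith [min_le_left ε 1]⟩
  have herr := ENNReal.tendsto_ofReal
    (RandomBreaker.tendsto_error (ρ := 1 - δ) (by linarith) (by linarith))
  rw [ENNReal.ofReal_zero] at herr
  have hlow := ENNReal.Tendsto.sub (tendsto_const_nhds (x := (1 : ENNReal))) herr
    (Or.inl ENNReal.one_ne_top)
  rw [tsub_zero] at hlow
  refine tendsto_of_tendsto_of_tendsto_of_le_of_le' hlow tendsto_const_nhds ?_
    (Eventually.of_forall fun n => RandomBreaker.winProb_le_one _ _ _ _ _)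
  filter_upwards [RandomBreaker.eventually_unclaimed_ge hδ hδ1,
    RandomBreaker.tendsto_fourthRoot_atTop.eventually_ge_atTop 2] with n hU hm
  have hs := RandomBreaker.fourthRoot_sq_le n
  have hs2 := Nat.sqrt_le' n
  set m := RandomBreaker.fourthRoot n
  have hmn : m ^ 2 + m ≤ n := by
    have h1 : m ^ 4 ≤ n := by
      calc m ^ 4 = (m ^ 2) ^ 2 := by rw [← pow_mul]
        _ ≤ n.sqrt ^ 2 := Nat.pow_le_pow_left hs 2
        _ ≤ n := hs2
    nlinarith [Nat.mul_le_mul hm hm, Nat.zero_le (m ^ 2 * m)]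
  have hn : (0 : ℝ) < n := by
    have : 0 < n := by omega
    exact_mod_cast this
  have hb : ((⌊(1 - ε) * (n : ℝ)⌋₊ : ℕ) : ℝ) ≤ (1 - 2 * δ) * n := by
    refine (Nat.cast_le.2 (Nat.floor_le_floor ?_)).trans
      (Nat.floor_le (mul_nonneg (by linarith) hn.le))
    gcongr
  have hU' := hU _ hb
  have hpos : 0 < δ * (n : ℝ) ^ 2 := by positivity
  refine tsub_le_iff_right.2
    (RandomBreaker.one_le_winProb_add _ (by omega) hmn (hpos.trans_le hU') ?_ (by linarith))
  have : δ ≤ ((n : ℝ) ^ 2 - ((n + 2 * m ^ 2 : ℕ) : ℝ) * ((⌊(1 - ε) * (n : ℝ)⌋₊ : ℕ) + 1))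
      / (n : ℝ) ^ 2 := by
    rw [le_div_iff₀ (by positivity)]
    exact hU'
  linarith
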